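/- Let $K$ be a field, let $d\ge 1$ and $n\ge d+1$ be integers, and let $S=K[x_1,\dots,x_n]$. Let $G$ be the $d$-path on the vertex set $\{1,\dots,n\}$, i.e. the union of the complete graphs on the vertex sets $\{1,\dots,d+1\},\{2,\dots,d+2\},\dots,\{n-d,\dots,n\}$. Let $\bar G$ be its complementary graph (the anti-$d$-path), and let $I=I(\bar G)\subset S$ be the edge ideal of $\bar G$, generated by the monomials $x_ix_j$ with $\{i,j\}\in E(\bar G)$. Write $\operatorname{Ass}_S(S/J)$ for the set of associated primes of $S/J$, and call an ideal $J\subset S$ normally torsion-free if $\operatorname{Ass}_S(S/J)=\operatorname{Ass}_S(S/J^k)$ for all $k\ge 1$. Then for all $k>1$ \[ \operatorname{Ass}_S(S/I^k)=\begin{cases}\operatorname{Ass}_S(S/I), & \text{if } d+2>n-d-1,\\ \operatorname{Ass}_S(S/I)\cup\{(x_1,\dots,x_n)\}, & \text{if } d+2\le n-d-1.\end{cases} \] In particular, $I$ is normally torsion-free if and only if $d+2>n-d-1$. If $d+2\le n-d-1$, then $I^2$ is normally torsion-free, and $\operatorname{Ass}_S(S/I^k)=\operatorname{Ass}_S(S/I^2)$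 for all $k\ge 2$. -/

import Mathlib

open MvPolynomial

/-- The `d`-path on `n` vertices: the union of the complete graphs on the windows of `d + 1`
consecutive vertices `{t, t + 1, …, t + d}` that fit into the vertex set. The vertices
`1, …, n` are indexed from `0` as the elements of `Fin n`. -/
def dPath (n d : ℕ) : SimpleGraph (Fin n) where
  Adj i j := i ≠ j ∧ ∃ t : ℕ, t + d < n ∧
    (t ≤ (i : ℕ) ∧ (i : ℕ) ≤ t + d) ∧ (t ≤ (j : ℕ) ∧ (j : ℕ) ≤ t + d)
  symm := ⟨fun _ _ ⟨hne, t, ht, hi, hj⟩ => ⟨hne.symm, t, ht, hj, hi⟩⟩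
  loopless := ⟨fun _ h => h.1 rfl⟩

/-- The anti-`d`-path: the complementary graph of the `d`-path. -/
def antiDPath (n d : ℕ) : SimpleGraph (Fin n) := (dPath n d)ᶜ

/-- The edge ideal of a graph `G` on the vertex set `σ`: the ideal of `K[x_v : v ∈ σ]` generated
by the monomials `x_i x_j` for the edges `{i, j}` of `G`. -/
noncomputable def edgeIdeal (K : Type*) [Field K] {σ : Type*} (G : SimpleGraph σ) :
    Ideal (MvPolynomial σ K) :=
  Ideal.span {p | ∃ i j : σ, G.Adj i j ∧ p = X i * X j}

/-- `Ass_R(R/I)`, the set of associated primes of the `R`-module `R/I`. -/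
def assQuot {R : Type*} [CommRing R] (I : Ideal R) : Set (Ideal R) :=
  associatedPrimes R (R ⧸ I)

/-- An ideal `I` is normally torsion-free if `Ass(R/I) = Ass(R/I^k)` for all `k ≥ 1`. -/
def IsNormallyTorsionFree {R : Type*} [CommRing R] (I : Ideal R) : Prop :=
  ∀ k : ℕ, 1 ≤ k → assQuot I = assQuot (I ^ k)

/-! Two vertices are adjacent in the anti-path exactly when they differ by more than `d`, so the
minimal primes of `I` are the ideals P_t generated by the variables off a window {t, …, t + d}. The
polynomials of order at least `k` in those variables form a P_t-primary ideal containing `I ^ k`.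
The combinatorial core is `pow_mul_monomial_mem_edgeIdeal_pow`: for at most d + 2 consecutive
windows, order at least `k` off each of them forces membership in `I ^ k`, after multiplying by `u ^
k` to absorb the variables outside their union. If n ≤ 2d + 2, all windows qualify with u = 1, so
every associated prime is some P_t. In general, if `X j` is not in `P`, the windows containing `j`
suffice with u = `X j`. So only the maximal ideal can be new. For n ≥ 2d + 3 a triangle x, y, z
provides a socle element xyz(xz)^k modulo `I ^ (k + 2)`; for the first power the maximal ideal is
excluded because `I` is the intersection of the P_t. -/

lemma mem_assQuot_iff {R : Type*} [CommRing R] [IsNoetherianRing R] {I P : Ideal R} :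
    P ∈ assQuot I ↔ P.IsPrime ∧ ∃ f : R, ∀ g : R, g ∈ P ↔ g * f ∈ I := by
  rw [assQuot, AssociatedPrimes.mem_iff, isAssociatedPrime_iff]
  refine and_congr_right fun _ => ⟨?_, ?_⟩
  · rintro ⟨x, hx⟩
    obtain ⟨f, rfl⟩ := Ideal.Quotient.mk_surjective x
    refine ⟨f, fun g => ?_⟩
    rw [hx, Submodule.mem_colon_singleton, Submodule.mem_bot, ← Ideal.Quotient.eq_zero_iff_mem,
      map_mul]
    rfl
  · rintro ⟨f, hf⟩
    refine ⟨Ideal.Quotient.mk I f, Ideal.ext fun g => ?_⟩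
    rw [hf, Submodule.mem_colon_singleton, Submodule.mem_bot, ← Ideal.Quotient.eq_zero_iff_mem,
      map_mul]
    rfl

lemma mem_assQuot_of_mem_minimalPrimes {R : Type*} [CommRing R] [IsNoetherianRing R]
    {I P : Ideal R} (h : P ∈ I.minimalPrimes) : P ∈ assQuot I := by
  apply Module.associatedPrimes.minimalPrimes_annihilator_subset_associatedPrimes R (R ⧸ I)
  rwa [Ideal.annihilator_quotient]

/-! ### Order of vanishing along a set of variables -/

section Order

variable {K : Type*} [Field K] {σ : Type*}

/-- The total degree of an exponent vector in the variables from `C`. -/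
def degreeIn (C : Finset σ) (m : σ →₀ ℕ) : ℕ := ∑ i ∈ C, m i

lemma degreeIn_add (C : Finset σ) (m m' : σ →₀ ℕ) :
    degreeIn C (m + m') = degreeIn C m + degreeIn C m' := by
  simp [degreeIn, Finset.sum_add_distrib]

lemma mul_mem_of_forall_mul_monomial_mem {J : Ideal (MvPolynomial σ K)}
    {u f : MvPolynomial σ K} (h : ∀ m ∈ f.support, u * monomial m 1 ∈ J) : u * f ∈ J := by
  rw [f.as_sum, Finset.mul_sum]
  refine Ideal.sum_mem _ fun m hm => ?_
  have h1 : u * monomial m (coeff m f) = C (coeff m f) * (u * monomial m 1) := by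
    rw [mul_left_comm, C_mul_monomial, mul_one]
  rw [h1]
  exact Ideal.mul_mem_left _ _ (h m hm)

lemma span_range_X_isMaximal :
    (Ideal.span (Set.range (X : σ → MvPolynomial σ K))).IsMaximal := by
  have h : Ideal.span (Set.range (X : σ → MvPolynomial σ K)) =
      RingHom.ker (constantCoeff (σ := σ) (R := K)) := by
    ext f
    rw [← Set.image_univ, mem_ideal_span_X_image, RingHom.mem_ker]
    refine ⟨fun h => ?_, fun h m hm => ?_⟩
    · by_contra h0
      obtain ⟨i, -, hi⟩ := h 0 (mem_support_iff.2 h0)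
      exact hi rfl
    · by_contra! h0
      have : m = 0 := Finsupp.ext fun i => h0 i trivial
      subst this
      exact mem_support_iff.1 hm h
  rw [h]
  exact RingHom.ker_isMaximal_of_surjective _ fun c => ⟨C c, constantCoeff_C _ _⟩

lemma exists_of_degreeIn_pos {C : Finset σ} {m : σ →₀ ℕ} (h : 0 < degreeIn C m) :
    ∃ i ∈ C, m i ≠ 0 :=
  Finset.exists_ne_zero_of_sum_ne_zero h.ne'

variable [DecidableEq σ]

lemma degreeIn_single (C : Finset σ) (i : σ) (r : ℕ) :
    degreeIn C (Finsupp.single i r) = if i ∈ C then r else 0 := by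
  simp [degreeIn, Finsupp.single_apply]

variable (K) in
/-- The homomorphism multiplying each variable from `C` by a new variable. -/
noncomputable def scaleHom (C : Finset σ) :
    MvPolynomial σ K →+* Polynomial (MvPolynomial σ K) :=
  eval₂Hom (Polynomial.C.comp MvPolynomial.C)
    (fun i => Polynomial.C (X i) * Polynomial.X ^ (if i ∈ C then 1 else 0))

lemma scaleHom_X (C : Finset σ) (i : σ) :
    scaleHom K C (X i) = Polynomial.C (X i) * Polynomial.X ^ (if i ∈ C then 1 else 0) := by
  simp [scaleHom]

lemma scaleHom_monomial (C : Finset σ) (m : σ →₀ ℕ) (c : K) :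
    scaleHom K C (monomial m c) =
      Polynomial.C (monomial m c) * Polynomial.X ^ degreeIn C m := by
  induction m using Finsupp.induction_linear generalizing c with
  | zero => simp [scaleHom, degreeIn]
  | add f g hf hg =>
    have h : monomial (f + g) c = monomial f c * monomial g (1 : K) := by
      rw [monomial_mul, mul_one]
    rw [h, map_mul, hf, hg, degreeIn_add, map_mul]
    ring
  | single i r =>
    have h : monomial (Finsupp.single i r) c = MvPolynomial.C c * X i ^ r := by
      rw [C_mul_X_pow_eq_monomial]
    rw [h, map_mul, map_pow, scaleHom_X, degreeIn_single, map_mul, map_pow]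
    have h' : scaleHom K C (MvPolynomial.C c) = Polynomial.C (MvPolynomial.C c) := by
      simp [scaleHom]
    rw [h']
    split_ifs <;> ring

/-- The new variable records the degree in `C`, so distinct monomials of `f` cannot cancel. -/
lemma coeff_coeff_scaleHom (C : Finset σ) (f : MvPolynomial σ K) (m : σ →₀ ℕ) :
    coeff m ((scaleHom K C f).coeff (degreeIn C m)) = coeff m f := by
  induction f using MvPolynomial.induction_on' with
  | monomial a b =>
    rw [scaleHom_monomial, Polynomial.coeff_C_mul, Polynomial.coeff_X_pow]
    by_cases h : a = m
    · subst h; simp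
    · split_ifs <;> simp [h, coeff_monomial]
  | add p q hp hq => rw [map_add, Polynomial.coeff_add, coeff_add, coeff_add, hp, hq]

variable (K) in
/-- The ideal of polynomials all of whose monomials have degree at least `k` in the variables
from `C`. -/
noncomputable def orderIdeal (C : Finset σ) (k : ℕ) : Ideal (MvPolynomial σ K) :=
  (Ideal.span {Polynomial.X ^ k}).comap (scaleHom K C)

lemma mem_orderIdeal {C : Finset σ} {k : ℕ} {f : MvPolynomial σ K} :
    f ∈ orderIdeal K C k ↔ Polynomial.X ^ k ∣ scaleHom K C f := by
  rw [orderIdeal, Ideal.mem_comap, Ideal.mem_span_singleton]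

lemma le_degreeIn_of_mem_orderIdeal {C : Finset σ} {k : ℕ} {f : MvPolynomial σ K}
    (hf : f ∈ orderIdeal K C k) {m : σ →₀ ℕ} (hm : m ∈ f.support) : k ≤ degreeIn C m := by
  rw [mem_orderIdeal, Polynomial.X_pow_dvd_iff] at hf
  by_contra! h
  have := coeff_coeff_scaleHom C f m
  rw [hf _ h, coeff_zero] at this
  exact mem_support_iff.1 hm this.symm

lemma X_mem_orderIdeal_one {C : Finset σ} {i : σ} :
    (X i : MvPolynomial σ K) ∈ orderIdeal K C 1 ↔ i ∈ C := by
  refine ⟨fun h => ?_, fun h => ?_⟩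
  · have := le_degreeIn_of_mem_orderIdeal h (m := Finsupp.single i 1) (by simp [support_X])
    rw [degreeIn_single] at this
    by_contra hi
    simp [hi] at this
  · rw [mem_orderIdeal, scaleHom_X, if_pos h]
    exact dvd_mul_left _ _

lemma orderIdeal_one_isPrime (C : Finset σ) : (orderIdeal K C 1).IsPrime := by
  have : (Ideal.span {(Polynomial.X : Polynomial (MvPolynomial σ K)) ^ 1}).IsPrime := by
    rw [pow_one, Ideal.span_singleton_prime Polynomial.X_ne_zero]
    exact Polynomial.prime_X
  exact Ideal.comap_isPrime _ _

lemma pow_le_orderIdeal {C : Finset σ} {I : Ideal (MvPolynomial σ K)} {r : ℕ}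
    (h : I ≤ orderIdeal K C r) (k : ℕ) : I ^ k ≤ orderIdeal K C (r * k) := by
  rw [orderIdeal, ← Ideal.map_le_iff_le_comap] at h ⊢
  rw [Ideal.map_pow, pow_mul, ← Ideal.span_singleton_pow]
  exact Ideal.pow_right_mono h k

/-- `orderIdeal C k` is primary with radical `orderIdeal C 1`. -/
lemma mem_orderIdeal_one_of_mul_mem {C : Finset σ} {k : ℕ} {f g : MvPolynomial σ K}
    (h : g * f ∈ orderIdeal K C k) (hf : f ∉ orderIdeal K C k) : g ∈ orderIdeal K C 1 := by
  rw [mem_orderIdeal] at *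
  rw [map_mul] at h
  by_contra hg
  rw [pow_one] at hg
  exact hf (Polynomial.prime_X.pow_dvd_of_dvd_mul_left k hg h)

lemma orderIdeal_one_le_span (C : Finset σ) :
    orderIdeal K C 1 ≤ Ideal.span (X '' (C : Set σ)) := by
  intro f hf
  rw [mem_ideal_span_X_image]
  intro m hm
  exact exists_of_degreeIn_pos (le_degreeIn_of_mem_orderIdeal hf hm)

/-- An ideal prime over a finite intersection of the primary ideals `orderIdeal (C t) k`, up to
saturation at an element outside of it, is one of their radicals. -/
lemma eq_orderIdeal_one_of_isPrime {ι : Type*} {s : Finset ι} {C : ι → Finset σ} {k : ℕ}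
    {J P : Ideal (MvPolynomial σ K)} (hP : P.IsPrime) {f u : MvPolynomial σ K}
    (hf : ∀ g, g ∈ P ↔ g * f ∈ J) (hu : u ∉ P) (hJ : ∀ t ∈ s, J ≤ orderIdeal K (C t) k)
    (hs : ∀ g, (∀ t ∈ s, g ∈ orderIdeal K (C t) k) → u * g ∈ J) :
    ∃ t ∈ s, P = orderIdeal K (C t) 1 := by
  have hle : s.inf (fun t => (orderIdeal K (C t) k).colon {f}) ≤ P := by
    intro g hg
    have hg' : u * (g * f) ∈ J := hs _ fun t ht => by
      have := Finset.inf_le (f := fun t => (orderIdeal K (C t) k).colon {f}) ht hg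
      simpa [Submodule.mem_colon_singleton] using this
    rw [← mul_assoc, ← hf] at hg'
    exact (hP.mem_or_mem hg').resolve_left hu
  -- A prime above a finite intersection lies above one member, and that single colon ideal already
  -- determines `P`.
  obtain ⟨t, ht, htP⟩ := hP.inf_le'.1 hle
  have hmem : ∀ g, g ∈ P ↔ g * f ∈ orderIdeal K (C t) k := fun g =>
    ⟨fun hg => hJ t ht ((hf g).1 hg), fun hg => htP (by
      simpa [Submodule.mem_colon_singleton] using hg)⟩
  have hfk : f ∉ orderIdeal K (C t) k := fun h =>
    hP.one_notMem ((hmem 1).2 (by rwa [one_mul]))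
  refine ⟨t, ht, Ideal.ext fun g => ⟨fun hg => ?_, fun hg => ?_⟩⟩
  · exact mem_orderIdeal_one_of_mul_mem ((hmem g).1 hg) hfk
  · apply hP.mem_of_pow_mem k
    rw [hmem]
    apply Ideal.mul_mem_right
    rw [mem_orderIdeal, map_pow]
    rw [mem_orderIdeal, pow_one] at hg
    exact pow_dvd_pow_of_dvd hg k

end Order

/-! ### Windows and edges of the anti-path -/

section AntiPath

variable {K : Type*} [Field K] {n d : ℕ}

lemma antiDPath_adj_of_lt {a b : Fin n} (h : (a : ℕ) + d < b) : (antiDPath n d).Adj a b := by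
  rw [antiDPath, SimpleGraph.compl_adj]
  refine ⟨fun e => by subst e; omega, ?_⟩
  rintro ⟨-, t, -, ⟨h1, h2⟩, h3, h4⟩
  omega

lemma antiDPath_adj_iff (hn : d + 1 ≤ n) {a b : Fin n} :
    (antiDPath n d).Adj a b ↔ (a : ℕ) + d < b ∨ (b : ℕ) + d < a := by
  refine ⟨fun h => ?_, ?_⟩
  · rw [antiDPath, SimpleGraph.compl_adj] at h
    by_contra! hab
    refine h.2 ⟨h.1, min (min a b) (n - 1 - d), ?_, ⟨?_, ?_⟩, ?_, ?_⟩ <;> omega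
  · rintro (h | h)
    · exact antiDPath_adj_of_lt h
    · exact (antiDPath_adj_of_lt h).symm

lemma X_mul_X_mem_edgeIdeal {a b : Fin n} (h : (a : ℕ) + d < b) :
    (X a * X b : MvPolynomial (Fin n) K) ∈ edgeIdeal K (antiDPath n d) :=
  Ideal.subset_span ⟨a, b, antiDPath_adj_of_lt h, rfl⟩

variable (n d) in
/-- The vertices outside of the window `{t, …, t + d}`. -/
def offWindow (t : ℕ) : Finset (Fin n) := {i | (i : ℕ) < t ∨ t + d < i}

lemma mem_offWindow {t : ℕ} {i : Fin n} : i ∈ offWindow n d t ↔ (i : ℕ) < t ∨ t + d < i := by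
  simp [offWindow]

lemma edgeIdeal_le_orderIdeal (hn : d + 1 ≤ n) (t : ℕ) :
    edgeIdeal K (antiDPath n d) ≤ orderIdeal K (offWindow n d t) 1 := by
  refine Ideal.span_le.2 ?_
  rintro _ ⟨i, j, h, rfl⟩
  rw [antiDPath_adj_iff hn] at h
  by_cases hi : i ∈ offWindow n d t
  · exact Ideal.mul_mem_right _ _ (X_mem_orderIdeal_one.2 hi)
  · refine Ideal.mul_mem_left _ _ (X_mem_orderIdeal_one.2 ?_)
    rw [mem_offWindow] at hi ⊢
    omega

lemma edgeIdeal_le_orderIdeal_univ :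
    edgeIdeal K (antiDPath n d) ≤ orderIdeal K Finset.univ 2 := by
  refine Ideal.span_le.2 ?_
  rintro _ ⟨i, j, -, rfl⟩
  rw [SetLike.mem_coe, mem_orderIdeal, map_mul, scaleHom_X, scaleHom_X]
  refine Dvd.intro (Polynomial.C (X i) * Polynomial.C (X j)) ?_
  simp only [Finset.mem_univ, if_true]
  ring

/-- The support of an exponent vector that meets the complement of every window contains an
edge. -/
lemma exists_edge_of_degreeIn_pos {m : Fin n →₀ ℕ} {t₀ t₁ : ℕ} (h₀₁ : t₀ ≤ t₁)
    (h : ∀ t, t₀ ≤ t → t ≤ t₁ → 0 < degreeIn (offWindow n d t) m)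
    (hs : ∀ i, m i ≠ 0 → t₀ ≤ (i : ℕ) ∧ (i : ℕ) ≤ t₁ + d) :
    ∃ a b : Fin n, m a ≠ 0 ∧ m b ≠ 0 ∧ (a : ℕ) + d < b := by
  obtain ⟨i, hi, hmi⟩ := exists_of_degreeIn_pos (h t₁ h₀₁ le_rfl)
  obtain ⟨a, ha, hmin⟩ := m.support.exists_min_image id ⟨i, Finsupp.mem_support_iff.2 hmi⟩
  have hmin' : ∀ j, m j ≠ 0 → (a : ℕ) ≤ j := fun j hj => hmin j (Finsupp.mem_support_iff.2 hj)
  rw [Finsupp.mem_support_iff] at ha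
  -- The support ends by t₁ + d, so a support vertex off the last window lies before t₁. Hence the
  -- window starting at the least support vertex `a` is admissible, and whatever is off it lies
  -- beyond a + d.
  have hat : (a : ℕ) < t₁ := by
    have h1 := hs i hmi
    have h2 := hmin' i hmi
    rw [mem_offWindow] at hi
    omega
  obtain ⟨b, hb, hmb⟩ := exists_of_degreeIn_pos (h a (hs a ha).1 hat.le)
  refine ⟨a, b, ha, hmb, ?_⟩
  have := hmin' b hmb
  rw [mem_offWindow] at hb
  omega

/-- A weighted König theorem for the edges inside of a union of consecutive windows: if the
degree off every window `{t, …, t + d}` with `t₀ ≤ t ≤ t₁` is at least `k`, then the monomial is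
divisible by a product of `k` edges and variables outside of the union. -/
lemma pow_mul_monomial_mem_edgeIdeal_pow {u : MvPolynomial (Fin n) K} {t₀ t₁ : ℕ}
    (h₀₁ : t₀ ≤ t₁) (h₁₀ : t₁ ≤ t₀ + d + 1)
    (hu : ∀ i : Fin n, ((i : ℕ) < t₀ ∨ t₁ + d < i) → u * X i ∈ edgeIdeal K (antiDPath n d))
    (k : ℕ) (m : Fin n →₀ ℕ)
    (h : ∀ t, t₀ ≤ t → t ≤ t₁ → k ≤ degreeIn (offWindow n d t) m) :
    u ^ k * monomial m 1 ∈ edgeIdeal K (antiDPath n d) ^ k := by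
  induction k generalizing m with
  | zero => simp
  | succ k ih =>
    by_cases hs : ∃ i, m i ≠ 0 ∧ ((i : ℕ) < t₀ ∨ t₁ + d < i)
    · obtain ⟨i, hmi, hi⟩ := hs
      obtain ⟨m', rfl⟩ : ∃ m', m = m' + Finsupp.single i 1 :=
        ⟨m - Finsupp.single i 1,
          (tsub_add_cancel_of_le (by simpa [Nat.one_le_iff_ne_zero] using hmi)).symm⟩
      have key := Ideal.mul_mem_mul (ih m' fun t h1 h2 => by
        have := h t h1 h2
        rw [degreeIn_add, degreeIn_single] at this
        split_ifs at this <;> omega) (hu i hi)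
      rw [pow_succ]
      convert key using 1
      rw [← mul_one (1 : K), ← monomial_mul, ← X, mul_one]
      ring
    · push Not at hs
      obtain ⟨a₀, b₀, ha₀, hb₀, hab₀⟩ := exists_edge_of_degreeIn_pos h₀₁
        (fun t h1 h2 => (Nat.succ_pos k).trans_le (h t h1 h2)) hs
      -- A shortest edge is split off: no support vertex lies strictly between a + d and `b`.
      obtain ⟨⟨a, b⟩, hab, hmin⟩ := Finset.exists_min_image
        {p : Fin n × Fin n | m p.1 ≠ 0 ∧ m p.2 ≠ 0 ∧ (p.1 : ℕ) + d < p.2}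
        (fun p => (p.2 : ℕ) - p.1) ⟨(a₀, b₀), by simp [ha₀, hb₀, hab₀]⟩
      simp only [Finset.mem_filter, Finset.mem_univ, true_and, Prod.forall] at hab hmin
      obtain ⟨ha, hb, hab⟩ := hab
      have hne : a ≠ b := by rintro rfl; omega
      have hba := hs b hb
      have haa := hs a ha
      -- Only windows missing both ends lose degree 2. Since t₁ ≤ t₀ + d + 1, such a window lies
      -- strictly between `a` and `b`; it misses all support off window `a`, and `a` as well, so its
      -- degree has one to spare.
      have hbig : ∀ t, t₀ ≤ t → t ≤ t₁ → a ∈ offWindow n d t → b ∈ offWindow n d t →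
          k + 2 ≤ degreeIn (offWindow n d t) m := by
        intro t h1 h2 hat hbt
        rw [mem_offWindow] at hat hbt
        have hle : ∑ i ∈ insert a (offWindow n d a), m i ≤ ∑ i ∈ offWindow n d t, m i := by
          refine Finset.sum_le_sum_of_ne_zero fun i hi hmi => ?_
          rw [mem_offWindow]
          rcases Finset.mem_insert.1 hi with rfl | hi
          · exact hat
          · rw [mem_offWindow] at hi
            rcases hi with hi | hi
            · omega
            · have := hmin a i ⟨ha, hmi, hi⟩
              omega
        rw [Finset.sum_insert (by rw [mem_offWindow]; omega)] at hle
        have hk := h a haa.1 (by omega)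
        unfold degreeIn at hk ⊢
        omega
      obtain ⟨m', rfl⟩ : ∃ m', m = m' + (Finsupp.single a 1 + Finsupp.single b 1) := by
        refine ⟨m - (Finsupp.single a 1 + Finsupp.single b 1),
          (tsub_add_cancel_of_le fun i => ?_).symm⟩
        simp only [Finsupp.add_apply, Finsupp.single_apply]
        split_ifs with h1 h2 h2
        · exact absurd (h1.trans h2.symm) hne
        · subst h1; omega
        · subst h2; omega
        · omega
      have key := Ideal.mul_mem_mul (ih m' fun t h1 h2 => by
        have h3 := h t h1 h2
        have h4 := hbig t h1 h2
        rw [degreeIn_add, degreeIn_add, degreeIn_single, degreeIn_single] at h3 h4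
        split_ifs at h3 h4 <;> first | omega | (have := h4 ‹_› ‹_›; omega))
        (X_mul_X_mem_edgeIdeal (K := K) hab)
      rw [pow_succ]
      have hm : (monomial (m' + (Finsupp.single a 1 + Finsupp.single b 1)) 1 :
          MvPolynomial (Fin n) K) = monomial m' 1 * (X a * X b) := by
        rw [X, X, monomial_mul, monomial_mul, mul_one, mul_one]
      rw [hm]
      convert Ideal.mul_mem_left _ u key using 1
      ring

/-! ### The window primes -/

lemma exists_eq_orderIdeal_of_notMem (hn : d + 1 ≤ n) {u : MvPolynomial (Fin n) K} {t₀ t₁ : ℕ}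
    (h₀₁ : t₀ ≤ t₁) (h₁₀ : t₁ ≤ t₀ + d + 1) (h₁ : t₁ + d < n)
    (hu : ∀ i : Fin n, ((i : ℕ) < t₀ ∨ t₁ + d < i) → u * X i ∈ edgeIdeal K (antiDPath n d))
    {k : ℕ} {P : Ideal (MvPolynomial (Fin n) K)}
    (hP : P ∈ assQuot (edgeIdeal K (antiDPath n d) ^ k)) (huP : u ∉ P) :
    ∃ t, t + d < n ∧ P = orderIdeal K (offWindow n d t) 1 := by
  obtain ⟨hprime, f, hf⟩ := mem_assQuot_iff.1 hP
  obtain ⟨t, ht, h⟩ := eq_orderIdeal_one_of_isPrime (s := Finset.Icc t₀ t₁)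
    (C := offWindow n d) (k := k) (u := u ^ k) hprime hf
    (fun h => huP (hprime.mem_of_pow_mem k h))
    (fun t _ => by simpa using pow_le_orderIdeal (edgeIdeal_le_orderIdeal (K := K) hn t) k)
    (fun g hg => mul_mem_of_forall_mul_monomial_mem fun m hm =>
      pow_mul_monomial_mem_edgeIdeal_pow h₀₁ h₁₀ hu k m fun t h1 h2 =>
        le_degreeIn_of_mem_orderIdeal (hg t (Finset.mem_Icc.2 ⟨h1, h2⟩)) hm)
  exact ⟨t, by have := (Finset.mem_Icc.1 ht).2; omega, h⟩

/-- A vertex left of the window is adjacent to its last vertex, one on the right to its first; a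
smaller prime contains neither window variable. -/
lemma orderIdeal_mem_minimalPrimes (hn : d + 1 ≤ n) {t : ℕ} (ht : t + d < n) :
    orderIdeal K (offWindow n d t) 1 ∈ (edgeIdeal K (antiDPath n d)).minimalPrimes := by
  refine ⟨⟨orderIdeal_one_isPrime _, edgeIdeal_le_orderIdeal hn t⟩, ?_⟩
  rintro P ⟨hP, hI⟩ hle
  refine (orderIdeal_one_le_span _).trans (Ideal.span_le.2 ?_)
  rintro _ ⟨i, hi, rfl⟩
  rw [Finset.mem_coe, mem_offWindow] at hi
  have hout : ∀ j : Fin n, t ≤ (j : ℕ) → (j : ℕ) ≤ t + d → (X j : MvPolynomial (Fin n) K) ∉ P := by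
    intro j h1 h2 h3
    have := X_mem_orderIdeal_one.1 (hle h3)
    rw [mem_offWindow] at this
    omega
  rcases hi with hi | hi
  · exact (hP.mem_or_mem (hI (X_mul_X_mem_edgeIdeal (a := i) (b := ⟨t + d, ht⟩)
      (by simpa using hi)))).resolve_right (hout _ (by simp) (by simp))
  · exact (hP.mem_or_mem (hI (X_mul_X_mem_edgeIdeal (a := ⟨t, by omega⟩) (b := i)
      (by simpa using hi)))).resolve_left (hout _ (by simp) (by simp))

lemma orderIdeal_mem_assQuot_pow (hn : d + 1 ≤ n) {t k : ℕ} (ht : t + d < n) (hk : 1 ≤ k) :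
    orderIdeal K (offWindow n d t) 1 ∈ assQuot (edgeIdeal K (antiDPath n d) ^ k) := by
  obtain ⟨⟨h1, h2⟩, h3⟩ := orderIdeal_mem_minimalPrimes (K := K) hn ht
  refine mem_assQuot_of_mem_minimalPrimes
    ⟨⟨h1, (Ideal.pow_le_self (by omega)).trans h2⟩, fun P hP hle => h3 ⟨hP.1, fun x hx => ?_⟩ hle⟩
  exact hP.1.mem_of_pow_mem k (hP.2 (Ideal.pow_mem_pow hx k))

lemma assQuot_pow_of_le (hn : d + 1 ≤ n) (h : n ≤ 2 * d + 2) {k : ℕ} (hk : 1 ≤ k) :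
    assQuot (edgeIdeal K (antiDPath n d) ^ k) =
      {P | ∃ t, t + d < n ∧ P = orderIdeal K (offWindow n d t) 1} := by
  ext P
  refine ⟨fun hP => ?_, ?_⟩
  · refine exists_eq_orderIdeal_of_notMem hn (u := 1) (t₀ := 0) (t₁ := n - 1 - d) (by omega)
      (by omega) (by omega) (fun i hi => ?_) hP ?_
    · have := i.2
      omega
    · exact (mem_assQuot_iff.1 hP).1.one_notMem
  · rintro ⟨t, ht, rfl⟩
    exact orderIdeal_mem_assQuot_pow hn ht hk

lemma eq_orderIdeal_or_eq_of_mem_assQuot_pow (hn : d + 1 ≤ n) {k : ℕ}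
    {P : Ideal (MvPolynomial (Fin n) K)}
    (hP : P ∈ assQuot (edgeIdeal K (antiDPath n d) ^ k)) :
    (∃ t, t + d < n ∧ P = orderIdeal K (offWindow n d t) 1) ∨
      P = Ideal.span (Set.range (X : Fin n → MvPolynomial (Fin n) K)) := by
  by_cases h : ∃ j : Fin n, (X j : MvPolynomial (Fin n) K) ∉ P
  · obtain ⟨j, hj⟩ := h
    have := j.2
    -- These are the windows through `j` (truncated subtraction handles j < d); every vertex outside
    -- their union is adjacent to `j`.
    refine .inl (exists_eq_orderIdeal_of_notMem hn (u := X j) (t₀ := j - d)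
      (t₁ := min j (n - 1 - d)) (by omega) (by omega) (by omega) (fun i hi => ?_) hP hj)
    have hi2 := i.2
    rcases hi with hi | hi
    · rw [mul_comm]
      exact X_mul_X_mem_edgeIdeal (by omega)
    · exact X_mul_X_mem_edgeIdeal (by omega)
  · push Not at h
    refine .inr (span_range_X_isMaximal.eq_of_le (mem_assQuot_iff.1 hP).1.ne_top ?_).symm
    rw [Ideal.span_le]
    rintro _ ⟨i, rfl⟩
    exact h i

/-! ### The maximal ideal -/

lemma span_range_X_mem_assQuot_pow (h : 2 * d + 3 ≤ n) {k : ℕ} (hk : 2 ≤ k) :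
    Ideal.span (Set.range (X : Fin n → MvPolynomial (Fin n) K)) ∈
      assQuot (edgeIdeal K (antiDPath n d) ^ k) := by
  obtain ⟨k, rfl⟩ := Nat.exists_eq_add_of_le' hk
  let x : Fin n := ⟨0, by omega⟩
  let y : Fin n := ⟨d + 1, by omega⟩
  let z : Fin n := ⟨n - 1, by omega⟩
  have hxy : (X x * X y : MvPolynomial (Fin n) K) ∈ edgeIdeal K (antiDPath n d) :=
    X_mul_X_mem_edgeIdeal (by simp [x, y])
  have hxz : (X x * X z : MvPolynomial (Fin n) K) ∈ edgeIdeal K (antiDPath n d) :=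
    X_mul_X_mem_edgeIdeal (by simp [x, z]; omega)
  have hyz : (X y * X z : MvPolynomial (Fin n) K) ∈ edgeIdeal K (antiDPath n d) :=
    X_mul_X_mem_edgeIdeal (by simp [y, z]; omega)
  have hmax := span_range_X_isMaximal (K := K) (σ := Fin n)
  -- Its degree 2k + 3 is one short of the least degree in `I ^ (k + 2)`.
  let f : MvPolynomial (Fin n) K := X x * X y * X z * (X x * X z) ^ k
  have hmul : ∀ i, X i * f ∈ edgeIdeal K (antiDPath n d) ^ (k + 2) := by
    intro i
    have hk' := Ideal.pow_mem_pow hxz k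
    rw [pow_add, pow_two]
    -- Each vertex is adjacent to `z` or to `x`; the opposite side of the triangle supplies the
    -- other edge.
    by_cases hi : (i : ℕ) ≤ d + 1
    · have hiz : (X i * X z : MvPolynomial (Fin n) K) ∈ edgeIdeal K (antiDPath n d) :=
        X_mul_X_mem_edgeIdeal (by simp [z]; omega)
      convert Ideal.mul_mem_mul hk' (Ideal.mul_mem_mul hiz hxy) using 1
      simp only [f]; ring
    · have hix : (X x * X i : MvPolynomial (Fin n) K) ∈ edgeIdeal K (antiDPath n d) :=
        X_mul_X_mem_edgeIdeal (by simp [x]; omega)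
      convert Ideal.mul_mem_mul hk' (Ideal.mul_mem_mul hix hyz) using 1
      simp only [f]; ring
  have hf : f ∉ edgeIdeal K (antiDPath n d) ^ (k + 2) := by
    intro hmem
    have h1 := pow_le_orderIdeal (edgeIdeal_le_orderIdeal_univ (K := K)) _ hmem
    let m : Fin n →₀ ℕ := Finsupp.single x 1 + Finsupp.single y 1 + Finsupp.single z 1 +
      (k • (Finsupp.single x 1 + Finsupp.single z 1))
    have hfm : f = monomial m 1 := by
      simp only [f, m, X, monomial_mul, monomial_pow, one_pow, mul_one]
    rw [hfm] at h1
    have h2 := le_degreeIn_of_mem_orderIdeal h1 (m := m) (by simp [mem_support_iff])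
    have hsm : ∀ p : Fin n →₀ ℕ, degreeIn Finset.univ (k • p) = k * degreeIn Finset.univ p := by
      intro p
      simp [degreeIn, Finset.mul_sum]
    simp only [m, degreeIn_add, hsm, degreeIn_single, Finset.mem_univ, if_true] at h2
    omega
  refine mem_assQuot_iff.2 ⟨hmax.isPrime, f, fun g => ?_⟩
  have heq := hmax.eq_of_le (J := (edgeIdeal K (antiDPath n d) ^ (k + 2)).colon {f})
    (fun htop => hf (by
      have h1 : (1 : MvPolynomial (Fin n) K) ∈
        (edgeIdeal K (antiDPath n d) ^ (k + 2)).colon {f} := by rw [htop]; trivial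
      simpa [Submodule.mem_colon_singleton] using h1))
    (Ideal.span_le.2 (by
      rintro _ ⟨i, rfl⟩
      simpa [Submodule.mem_colon_singleton] using hmul i))
  rw [heq, Submodule.mem_colon_singleton, smul_eq_mul]

lemma span_range_X_notMem_assQuot (hn : d + 1 ≤ n) :
    Ideal.span (Set.range (X : Fin n → MvPolynomial (Fin n) K)) ∉
      assQuot (edgeIdeal K (antiDPath n d)) := by
  intro hmem
  obtain ⟨hprime, f, hf⟩ := mem_assQuot_iff.1 hmem
  -- A window variable times `f` lies in P_t, but the variable does not. So `f` lies in every P_t,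
  -- hence in `I`.
  have hft : ∀ t, t + d < n → f ∈ orderIdeal K (offWindow n d t) 1 := by
    intro t ht
    let j : Fin n := ⟨t, by omega⟩
    have h1 := edgeIdeal_le_orderIdeal hn t ((hf (X j)).1 (Ideal.subset_span ⟨j, rfl⟩))
    refine ((orderIdeal_one_isPrime _).mem_or_mem h1).resolve_left fun h2 => ?_
    have := X_mem_orderIdeal_one.1 h2
    rw [mem_offWindow] at this
    simp [j] at this
  refine hprime.one_notMem ((hf 1).2 (mul_mem_of_forall_mul_monomial_mem fun m hm => ?_))
  obtain ⟨a, b, ha, hb, hab⟩ := exists_edge_of_degreeIn_pos (d := d) (m := m) (t₀ := 0)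
    (t₁ := n - 1 - d) (by omega)
    (fun t _ h2 => le_degreeIn_of_mem_orderIdeal (hft t (by omega)) hm)
    (fun i _ => by have := i.2; omega)
  have hne : a ≠ b := by rintro rfl; omega
  have hle : Finsupp.single a 1 + Finsupp.single b 1 ≤ m := fun i => by
    simp only [Finsupp.add_apply, Finsupp.single_apply]
    split_ifs with h1 h2 h2
    · exact absurd (h1.trans h2.symm) hne
    · subst h1; omega
    · subst h2; omega
    · omega
  have hm' : (monomial m 1 : MvPolynomial (Fin n) K) =
      monomial (m - (Finsupp.single a 1 + Finsupp.single b 1)) 1 * (X a * X b) := by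
    rw [X, X, monomial_mul, monomial_mul, mul_one, mul_one, tsub_add_cancel_of_le hle]
  rw [hm', ← mul_assoc]
  exact Ideal.mul_mem_left _ _ (X_mul_X_mem_edgeIdeal hab)

lemma assQuot_pow_of_lt (h : 2 * d + 3 ≤ n) {k : ℕ} (hk : 2 ≤ k) :
    assQuot (edgeIdeal K (antiDPath n d) ^ k) =
      assQuot (edgeIdeal K (antiDPath n d)) ∪
        {Ideal.span (Set.range (X : Fin n → MvPolynomial (Fin n) K))} := by
  have hn : d + 1 ≤ n := by omega
  ext P
  refine ⟨fun hP => ?_, ?_⟩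
  · rcases eq_orderIdeal_or_eq_of_mem_assQuot_pow hn hP with ⟨t, ht, rfl⟩ | rfl
    · exact .inl (by simpa using orderIdeal_mem_assQuot_pow (K := K) hn ht le_rfl)
    · exact .inr rfl
  · rintro (hP | rfl)
    · rw [← pow_one (edgeIdeal K (antiDPath n d))] at hP
      rcases eq_orderIdeal_or_eq_of_mem_assQuot_pow hn hP with ⟨t, ht, rfl⟩ | rfl
      · exact orderIdeal_mem_assQuot_pow hn ht (by omega)
      · exact span_range_X_mem_assQuot_pow h hk
    · exact span_range_X_mem_assQuot_pow h hk

end AntiPath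

theorem mainTheorem1 {K : Type*} [Field K] (n d : ℕ) (hd : 1 ≤ d) (hn : d + 1 ≤ n)
    (I : Ideal (MvPolynomial (Fin n) K)) (hI : I = edgeIdeal K (antiDPath n d)) :
    (∀ k : ℕ, 1 < k →
      ((d : ℤ) + 2 > (n : ℤ) - d - 1 → assQuot (I ^ k) = assQuot I) ∧
      ((d : ℤ) + 2 ≤ (n : ℤ) - d - 1 →
        assQuot (I ^ k) =
          assQuot I ∪ {Ideal.span (Set.range (X : Fin n → MvPolynomial (Fin n) K))})) ∧
    (IsNormallyTorsionFree I ↔ (d : ℤ) + 2 > (n : ℤ) - d - 1) ∧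
    ((d : ℤ) + 2 ≤ (n : ℤ) - d - 1 →
      IsNormallyTorsionFree (I ^ 2) ∧ ∀ k : ℕ, 2 ≤ k → assQuot (I ^ k) = assQuot (I ^ 2)) := by
  subst hI
  have hsmall : (d : ℤ) + 2 > (n : ℤ) - d - 1 → ∀ k, 1 ≤ k →
      assQuot (edgeIdeal K (antiDPath n d) ^ k) = assQuot (edgeIdeal K (antiDPath n d)) := by
    intro h k hk
    have h1 := assQuot_pow_of_le (K := K) hn (by omega) (le_refl 1)
    rw [pow_one] at h1
    rw [h1, assQuot_pow_of_le hn (by omega) hk]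
  refine ⟨fun k hk => ⟨fun h => hsmall h k hk.le, fun h => assQuot_pow_of_lt (by omega) hk⟩,
    ⟨fun hfree => ?_, fun h k hk => (hsmall h k hk).symm⟩, fun h => ⟨fun k hk => ?_, fun k hk => ?_⟩⟩
  · by_contra h
    have h2 := span_range_X_mem_assQuot_pow (K := K) (n := n) (d := d) (by omega) le_rfl
    rw [← hfree 2 (by omega)] at h2
    exact span_range_X_notMem_assQuot hn h2
  · rw [← pow_mul, assQuot_pow_of_lt (by omega) le_rfl, assQuot_pow_of_lt (by omega) (by omega)]
  · rw [assQuot_pow_of_lt (by omega) le_rfl, assQuot_pow_of_lt (by omega) hk]
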